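/- \textbf{Setting.} Let $\mathbf{C}$ be an adhesive category: $\mathbf{C}$ has pullbacks and has pushouts along monomorphisms, and pushouts along monomorphisms are van Kampen squares. Given $A\xrightarrow{a}B\xrightarrow{c}X$, a pair $A\xrightarrow{b}D\xrightarrow{d}X$ is a \emph{final pullback complement (FPC)} of it if $(a,b)$ is a pullback of $(c,d)$ and, for all $z:T\to X$, every pullback $(x:P\to B,\;y:P\to T)$ of $(c,z)$ and every $w:P\to A$ with $a\circ w=x$, there is a unique $w^*:T\to D$ with $d\circ w^*=z$ and $w^*\circ y=b\circ w$. Assume that every composable pair of monomorphisms of $\mathbf{C}$ has an FPC, and that FPCs of pairs of monomorphisms are pairs of monomorphisms. A \emph{linear production} is a span of monomorphisms $p=(O\xleftarrow{o}K\xrightarrow{i}I)$; two linear productions are isomorphic ($\cong$) if there are isomorphisms $O\cong O'$, $K\cong K'$, $I\cong I'$ commuting with the legs. For linear productions $p_j=(O_j\xleftarrow{o_j}K_j\xrightarrow{i_j}I_j)$, $j=1,2$, an \emph{SqPO-admissible match} of $p_2$ into $p_1$ is a span of monomorphisms $\mathbf{m}=(I_2\xleftarrow{m_2}M\xrightarrow{m_1}O_1)$,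 taken up to isomorphism of $M$ over $I_2$ and $O_1$, such that for the pushout $I_2\xrightarrow{n_2}N\xleftarrow{n_1}O_1$ of $\mathbf{m}$ the pair $K_1\xrightarrow{o_1}O_1\xrightarrow{n_1}N$ has a pushout complement $K_1\xrightarrow{k_1}\overline K_1\xrightarrow{o_1'}N$. In this case let $I_{21}$, with $i_1':\overline K_1\to I_{21}$, be the pushout of $I_1\xleftarrow{i_1}K_1\xrightarrow{k_1}\overline K_1$; let $K_2\xrightarrow{k_2}\overline K_2\xrightarrow{i_2'}N$ be the FPC of $K_2\xrightarrow{i_2}I_2\xrightarrow{n_2}N$; let $O_{21}$, with $o_2':\overline K_2\to O_{21}$, be the pushout of $O_2\xleftarrow{o_2}K_2\xrightarrow{k_2}\overline K_2$; and let $\overline K_2\xleftarrow{i_2''}K_{21}\xrightarrow{o_1''}\overline K_1$ be the pullback of $\overline K_2\xrightarrow{i_2'}N\xleftarrow{o_1'}\overline K_1$. The \emph{composite} of $p_2$ with $p_1$ along $\mathbf{m}$ is the linear production $$p_2\stackrel{\mathbf m}{\triangleleft}p_1:=(O_{21}\xleftarrow{\,o_2'\circ i_2''\,}K_{21}\xrightarrow{\,i_1'\circ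 o_1''\,}I_{21}),$$ which is determined up to isomorphism; fix a representative of each composite. \textbf{Theorem (SqPO-type associativity theorem).} Let $p_1,p_2,p_3$ be linear productions of $\mathbf{C}$. There is a bijection from the set of pairs $(\mathbf m_{21},\mathbf m_{3(21)})$, where $\mathbf m_{21}$ is an SqPO-admissible match of $p_2$ into $p_1$ and $\mathbf m_{3(21)}$ is an SqPO-admissible match of $p_3$ into $p_2\stackrel{\mathbf m_{21}}{\triangleleft}p_1$, onto the set of pairs $(\mathbf m_{32},\mathbf m_{(32)1})$, where $\mathbf m_{32}$ is an SqPO-admissible match of $p_3$ into $p_2$ and $\mathbf m_{(32)1}$ is an SqPO-admissible match of $p_3\stackrel{\mathbf m_{32}}{\triangleleft}p_2$ into $p_1$, such that for corresponding pairs $$p_3\stackrel{\mathbf m_{3(21)}}{\triangleleft}\bigl(p_2\stackrel{\mathbf m_{21}}{\triangleleft}p_1\bigr)\;\cong\;\bigl(p_3\stackrel{\mathbf m_{32}}{\triangleleft}p_2\bigr)\stackrel{\mathbf m_{(32)1}}{\triangleleft}p_1 .$$ -/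

import Mathlib

open CategoryTheory CategoryTheory.Limits

universe v u

namespace SqPO

/-- Given `A --a--> B --c--> X`, the pair `A --b--> D --d--> X` is a final pullback complement
(FPC) of it: the square `A, B, X, D` is a pullback, and for every `z : T ⟶ X`, every pullback
`(x, y)` of `(c, z)` and every `w` with `w ≫ a = x`, there is a unique `w' : T ⟶ D` with
`w' ≫ d = z` and `y ≫ w' = w ≫ b`. -/
structure IsFPC {C : Type u} [Category.{v} C] {A B D X : C}
    (a : A ⟶ B) (c : B ⟶ X) (b : A ⟶ D) (d : D ⟶ X) : Prop where
  isPullback : IsPullback a b c d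
  existsUnique_lift : ∀ {P T : C} (x : P ⟶ B) (y : P ⟶ T) (z : T ⟶ X) (w : P ⟶ A),
    IsPullback x y c z → w ≫ a = x → ∃! w' : T ⟶ D, w' ≫ d = z ∧ y ≫ w' = w ≫ b

/-- All FPCs of composable pairs of monomorphisms exist, and monomorphisms are stable under
FPCs, i.e. FPCs of pairs of monomorphisms are pairs of monomorphisms. -/
class HasMonoFPCs (C : Type u) [Category.{v} C] : Prop where
  exists_isFPC : ∀ {A B X : C} (a : A ⟶ B) (c : B ⟶ X) [Mono a] [Mono c],
    ∃ (D : C) (b : A ⟶ D) (d : D ⟶ X), IsFPC a c b d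
  mono_of_isFPC : ∀ {A B D X : C} {a : A ⟶ B} {c : B ⟶ X} {b : A ⟶ D} {d : D ⟶ X}
    [Mono a] [Mono c], IsFPC a c b d → Mono b ∧ Mono d

/-- A linear production `O ⟵ K ⟶ I`: a span of monomorphisms. -/
structure LinearProduction (C : Type u) [Category.{v} C] where
  O : C
  K : C
  I : C
  o : K ⟶ O
  i : K ⟶ I
  [mono_o : Mono o]
  [mono_i : Mono i]

attribute [instance] LinearProduction.mono_o LinearProduction.mono_i

/-- Two linear productions are isomorphic if there are isomorphisms of their output, context and
input objects that commute with the legs of the two spans. -/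
def LinearProduction.IsIsomorphic {C : Type u} [Category.{v} C]
    (p q : LinearProduction C) : Prop :=
  ∃ (eO : p.O ≅ q.O) (eK : p.K ≅ q.K) (eI : p.I ≅ q.I),
    p.o ≫ eO.hom = eK.hom ≫ q.o ∧ p.i ≫ eI.hom = eK.hom ≫ q.i

/-- A span of monomorphisms `I₂ ⟵ M ⟶ O₁` overlapping the input of `p₂` with the output of
`p₁`. -/
structure Overlap {C : Type u} [Category.{v} C] (p₂ p₁ : LinearProduction C) where
  M : C
  m₂ : M ⟶ p₂.I
  m₁ : M ⟶ p₁.O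
  [mono_m₂ : Mono m₂]
  [mono_m₁ : Mono m₁]

attribute [instance] Overlap.mono_m₂ Overlap.mono_m₁

/-- An overlap is SqPO-admissible if, for the pushout `I₂ --n₂--> N <--n₁-- O₁` of the overlap,
the composable pair `K₁ --o₁--> O₁ --n₁--> N` has a pushout complement. -/
def Overlap.IsAdmissible {C : Type u} [Category.{v} C] {p₂ p₁ : LinearProduction C}
    (m : Overlap p₂ p₁) : Prop :=
  ∃ (N : C) (n₂ : p₂.I ⟶ N) (n₁ : p₁.O ⟶ N), IsPushout m.m₂ m.m₁ n₂ n₁ ∧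
    ∃ (Kbar₁ : C) (k₁ : p₁.K ⟶ Kbar₁) (o₁' : Kbar₁ ⟶ N), IsPushout p₁.o k₁ n₁ o₁'

/-- Admissible overlaps are identified along isomorphisms of the apex that commute with the legs. -/
instance overlapSetoid {C : Type u} [Category.{v} C] (p₂ p₁ : LinearProduction C) :
    Setoid {m : Overlap p₂ p₁ // m.IsAdmissible} where
  r m m' := ∃ e : m.1.M ≅ m'.1.M, e.hom ≫ m'.1.m₂ = m.1.m₂ ∧ e.hom ≫ m'.1.m₁ = m.1.m₁
  iseqv :=
    { refl := fun _ => ⟨Iso.refl _, by simp, by simp⟩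
      symm := by
        rintro _ _ ⟨e, h₂, h₁⟩
        exact ⟨e.symm, by simp [← h₂], by simp [← h₁]⟩
      trans := by
        rintro _ _ _ ⟨e, h₂, h₁⟩ ⟨f, g₂, g₁⟩
        exact ⟨e ≪≫ f, by simp [g₂, h₂], by simp [g₁, h₁]⟩ }

/-- The set of SqPO-admissible matches of `p₂` into `p₁`. -/
def AdmissibleMatch {C : Type u} [Category.{v} C] (p₂ p₁ : LinearProduction C) : Type (max u v) :=
  Quotient (overlapSetoid p₂ p₁)

/-- The diagram of an SqPO-type concurrent composition along an overlap `m`. Its upper row is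
`O₂ ⟵ K₂ ⟶ I₂ ⟵ M ⟶ O₁ ⟵ K₁ ⟶ I₁`, its lower row is
`O₂₁ ⟵ Kbar₂ ⟶ N ⟵ Kbar₁ ⟶ I₂₁`, and the squares between the two rows are, from left to right,
a pushout, an FPC, the pushout of `m`, a pushout complement and a pushout. Below it, `K₂₁` is the
pullback of `Kbar₂ ⟶ N ⟵ Kbar₁`. -/
structure CompositionDiagram {C : Type u} [Category.{v} C] {p₂ p₁ : LinearProduction C}
    (m : Overlap p₂ p₁) where
  N : C
  n₂ : p₂.I ⟶ N
  n₁ : p₁.O ⟶ N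
  isPushout_N : IsPushout m.m₂ m.m₁ n₂ n₁
  Kbar₁ : C
  k₁ : p₁.K ⟶ Kbar₁
  o₁' : Kbar₁ ⟶ N
  isPushout_complement : IsPushout p₁.o k₁ n₁ o₁'
  I₂₁ : C
  nstar₁ : p₁.I ⟶ I₂₁
  i₁' : Kbar₁ ⟶ I₂₁
  isPushout_I : IsPushout p₁.i k₁ nstar₁ i₁'
  Kbar₂ : C
  k₂ : p₂.K ⟶ Kbar₂
  i₂' : Kbar₂ ⟶ N
  isFPC : IsFPC p₂.i n₂ k₂ i₂'
  O₂₁ : C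
  nstar₂ : p₂.O ⟶ O₂₁
  o₂' : Kbar₂ ⟶ O₂₁
  isPushout_O : IsPushout p₂.o k₂ nstar₂ o₂'
  K₂₁ : C
  i₂'' : K₂₁ ⟶ Kbar₂
  o₁'' : K₂₁ ⟶ Kbar₁
  isPullback_K : IsPullback i₂'' o₁'' i₂' o₁'

section

variable {C : Type u} [Category.{v} C] [HasPullbacks C] [Adhesive C] [HasMonoFPCs C]
  {p₂ p₁ : LinearProduction C}

/-- The composition diagram of an admissible overlap exists. -/
theorem CompositionDiagram.nonempty {m : Overlap p₂ p₁} (hm : m.IsAdmissible) :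
    Nonempty (CompositionDiagram m) := by
  obtain ⟨N, n₂, n₁, hN, Kb, k₁, o', hK⟩ := hm
  have : Mono n₂ := Adhesive.mono_of_isPushout_of_mono_right hN
  obtain ⟨D, b, d, hF⟩ := HasMonoFPCs.exists_isFPC p₂.i n₂
  exact ⟨⟨N, n₂, n₁, hN, Kb, k₁, o', hK, _, _, _, IsPushout.of_hasPushout p₁.i k₁,
    D, b, d, hF, _, _, _, IsPushout.of_hasPushout p₂.o b, _, _, _,
    IsPullback.of_hasPullback d o'⟩⟩

/-- The span `O₂₁ ⟵ K₂₁ ⟶ I₂₁` read off a composition diagram. -/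
def CompositionDiagram.composite {m : Overlap p₂ p₁} (D : CompositionDiagram m) :
    LinearProduction C where
  O := D.O₂₁
  K := D.K₂₁
  I := D.I₂₁
  o := D.i₂'' ≫ D.o₂'
  i := D.o₁'' ≫ D.i₁'
  mono_o := by
    have : Mono D.o₁' := Adhesive.mono_of_isPushout_of_mono_left D.isPushout_complement
    have : Mono D.o₂' := Adhesive.mono_of_isPushout_of_mono_left D.isPushout_O
    have : Mono D.i₂'' := (MorphismProperty.monomorphisms C).of_isPullback
      D.isPullback_K.flip (MorphismProperty.monomorphisms.infer_property D.o₁')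
    exact mono_comp _ _
  mono_i := by
    have : Mono D.n₂ := Adhesive.mono_of_isPushout_of_mono_right D.isPushout_N
    have : Mono D.i₂' := (HasMonoFPCs.mono_of_isFPC D.isFPC).2
    have : Mono D.i₁' := Adhesive.mono_of_isPushout_of_mono_left D.isPushout_I
    have : Mono D.o₁'' := (MorphismProperty.monomorphisms C).of_isPullback
      D.isPullback_K (MorphismProperty.monomorphisms.infer_property D.i₂')
    exact mono_comp _ _

/-- The composite of `p₂` with `p₁` along an admissible match: a chosen representative of the
composite, which is determined up to isomorphism. -/
noncomputable def comp (p₂ : LinearProduction C) {p₁ : LinearProduction C}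
    (m : AdmissibleMatch p₂ p₁) : LinearProduction C :=
  (Classical.choice (CompositionDiagram.nonempty (Quotient.out m).2)).composite

end

end SqPO

/-!
The FPC of a composable pair of monomorphisms `A ⟶ B ⟶ X` is the largest subobject of `X` whose
intersection with `B` lies in `A`. It follows that FPCs paste horizontally: if `D` is the FPC in
`X`, then the FPC of `A ⟶ B ⟶ X ⟶ Y` is the FPC of `D ⟶ X ⟶ Y`. Hence the context of `p₂` in a
nested composition can be computed in stages.

Two nested compositions correspond to each other iff they have a common refinement, in which the
context of `p₂` glues its contexts in the two inner compositions. Starting from `p₃ ◁ (p₂ ◁ p₁)`,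
with `O₂₁ ⟶ N` the leg of the outer pushout, this glued context is the pushout complement of
`Kbar₂ ⟶ O₂₁ ⟶ N`; starting from `(p₃ ◁ p₂) ◁ p₁`, with `I₃₂ ⟶ X` the leg of the outer pushout, it
is the FPC of `Kbar₁ ⟶ I₃₂ ⟶ X`. Either description determines the refinement, which yields the
bijection, and both composites can be read off from the refinement as the same span.
-/

namespace SqPO

variable {C : Type u} [Category.{v} C]

theorem isPullback_id_of_mono {X Y Z : C} (h : X ⟶ Y) (u : Y ⟶ Z) [Mono u] :
    IsPullback h (𝟙 X) u (h ≫ u) := by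
  simpa using (IsPullback.of_id_snd (f := h)).paste_horiz (IsKernelPair.id_of_mono u)

theorem isPullback_of_comp_mono {W X Y Y' Z : C} {f : W ⟶ X} {g : W ⟶ Y} {t : Y ⟶ Y'} {h : X ⟶ Z}
    {i : Y' ⟶ Z} [Mono t] (H : IsPullback f (g ≫ t) h i) : IsPullback f g h (t ≫ i) := by
  simpa using (isPullback_id_of_mono g t).flip.paste_horiz H

theorem isPullback_comp_mono {W X Y Z Z' : C} {f : W ⟶ X} {g : W ⟶ Y} {h : X ⟶ Z} {i : Y ⟶ Z}
    (H : IsPullback f g h i) (u : Z ⟶ Z') [Mono u] : IsPullback f g (h ≫ u) (i ≫ u) :=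
  ⟨⟨by simp only [H.w_assoc]⟩, ⟨PullbackCone.isLimitOfCompMono h i u H.cone H.isLimit⟩⟩

theorem exists_lift_of_isPushout_of_legs {W X Y Z D E : C} {f : W ⟶ X} {g : W ⟶ Y} {h : X ⟶ Z}
    {i : Y ⟶ Z} (H : IsPushout f g h i) {e : Z ⟶ E} (d : D ⟶ E) [Mono d]
    (hX : ∃ l, l ≫ d = h ≫ e) (hY : ∃ l, l ≫ d = i ≫ e) : ∃ l, l ≫ d = e := by
  obtain ⟨x, hx⟩ := hX
  obtain ⟨y, hy⟩ := hY
  obtain ⟨l, rfl, rfl⟩ := H.exists_desc x y (by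
    rw [← cancel_mono d, Category.assoc, Category.assoc, hx, hy, H.w_assoc])
  exact ⟨l, H.hom_ext (by simpa using hx) (by simpa using hy)⟩

/-- The part of `z : T ⟶ X` that lies over `c : B ⟶ X` factors through `a : A ⟶ B`, formulated with
generalized elements of that part so that no pullback has to be chosen. The FPC of a composable pair
`(a, c)` of monomorphisms is the largest subobject of `X` with this property. -/
def MeetsWithin {A B T X : C} (z : T ⟶ X) (c : B ⟶ X) (a : A ⟶ B) : Prop :=
  ∀ ⦃P : C⦄ (p : P ⟶ T) (x : P ⟶ B), p ≫ z = x ≫ c → ∃ l, l ≫ a = x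

theorem MeetsWithin.of_isPullback {A B D X : C} {a : A ⟶ B} {c : B ⟶ X} {b : A ⟶ D} {d : D ⟶ X}
    (H : IsPullback a b c d) : MeetsWithin d c a :=
  fun _ p x hp => ⟨H.lift x p hp.symm, H.lift_fst x p hp.symm⟩

theorem isPullback_of_meetsWithin {A B D X : C} {a : A ⟶ B} {c : B ⟶ X} {b : A ⟶ D} {d : D ⟶ X}
    [Mono a] [Mono d] (w : a ≫ c = b ≫ d) (H : MeetsWithin d c a) : IsPullback a b c d :=
  .mk' w (fun _ _ _ h _ => (cancel_mono a).1 h) fun T x y h => by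
    obtain ⟨l, rfl⟩ := H y x h.symm
    exact ⟨l, rfl, (cancel_mono d).1 (by rw [← h, Category.assoc, Category.assoc, w])⟩

namespace IsFPC

variable {A B D X : C} {a : A ⟶ B} {c : B ⟶ X} {b : A ⟶ D} {d : D ⟶ X}

theorem of_exists_lift [Mono d] (H : IsPullback a b c d)
    (hl : ∀ ⦃T : C⦄ (z : T ⟶ X), MeetsWithin z c a → ∃ l, l ≫ d = z) : IsFPC a c b d := by
  refine ⟨H, fun {P T} x y z w hp hw => ?_⟩
  obtain ⟨l, rfl⟩ := hl z fun _ p x' hp' => ⟨hp.lift x' p hp'.symm ≫ w, by simp [hw]⟩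
  refine ⟨l, ⟨rfl, ?_⟩, fun l' h' => (cancel_mono d).1 h'.1⟩
  rw [← cancel_mono d, Category.assoc, ← hp.w, Category.assoc, ← H.w, reassoc_of% hw]

theorem existsUnique_hom {X' D' : C} {c' : B ⟶ X'} {b' : A ⟶ D'} {d' : D' ⟶ X'}
    (F : IsFPC a c b d) (F' : IsFPC a c' b' d') (e : X ≅ X') (he : c ≫ e.hom = c') :
    ∃! k : D ⟶ D', k ≫ d' = d ≫ e.hom ∧ b ≫ k = b' := by
  have H : IsPullback a b c' (d ≫ e.hom) := he ▸ isPullback_comp_mono F.isPullback e.hom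
  simpa using F'.existsUnique_lift a b (d ≫ e.hom) (𝟙 A) H (Category.id_comp a)

theorem exists_iso {X' D' : C} {c' : B ⟶ X'} {b' : A ⟶ D'} {d' : D' ⟶ X'}
    (F : IsFPC a c b d) (F' : IsFPC a c' b' d') (e : X ≅ X') (he : c ≫ e.hom = c') :
    ∃ k : D ≅ D', k.hom ≫ d' = d ≫ e.hom ∧ b ≫ k.hom = b' := by
  obtain ⟨k, ⟨hk, hbk⟩, -⟩ := F.existsUnique_hom F' e he
  obtain ⟨l, ⟨hl, hbl⟩, -⟩ := F'.existsUnique_hom F e.symm (by simp [← he])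
  refine ⟨⟨k, l, ?_, ?_⟩, hk, hbk⟩
  · exact (F.existsUnique_hom F (Iso.refl X) (by simp)).unique
      ⟨by simp [hl, reassoc_of% hk], by rw [reassoc_of% hbk, hbl]⟩ (by simp)
  · exact (F'.existsUnique_hom F' (Iso.refl X') (by simp)).unique
      ⟨by simp [hk, reassoc_of% hl], by rw [reassoc_of% hbl, hbk]⟩ (by simp)

variable [HasPullbacks C]

theorem exists_lift (F : IsFPC a c b d) {T : C} {z : T ⟶ X} (hz : MeetsWithin z c a) :
    ∃ l, l ≫ d = z := by
  have H := IsPullback.of_hasPullback c z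
  obtain ⟨l, hl⟩ := hz _ _ H.w.symm
  obtain ⟨w, ⟨hw, -⟩, -⟩ := F.existsUnique_lift _ _ z l H hl
  exact ⟨w, hw⟩

theorem meetsWithin_comp_iff (F : IsFPC a c b d) {T Y : C} (z : T ⟶ Y) (u : X ⟶ Y) :
    MeetsWithin z (c ≫ u) a ↔ MeetsWithin z u d := by
  constructor
  · exact fun hz _ p x hp => F.exists_lift fun _ q y hq =>
      hz (q ≫ p) y (by rw [Category.assoc, hp, reassoc_of% hq])
  · intro hz _ p x hp
    obtain ⟨l, hl⟩ := hz p (x ≫ c) (by simpa using hp)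
    exact MeetsWithin.of_isPullback F.isPullback l x hl

theorem paste_horiz {E Y : C} {u : X ⟶ Y} {s : D ⟶ E} {e : E ⟶ Y} [Mono e]
    (F : IsFPC a c b d) (G : IsFPC d u s e) : IsFPC a (c ≫ u) (b ≫ s) e :=
  of_exists_lift (F.isPullback.flip.paste_horiz G.isPullback.flip).flip
    fun _ z hz => G.exists_lift ((F.meetsWithin_comp_iff z u).1 hz)

theorem of_paste_horiz {E Y : C} {u : X ⟶ Y} {s : D ⟶ E} {e : E ⟶ Y} {b' : A ⟶ E} [Mono d] [Mono e]
    (F : IsFPC a c b d) (G : IsFPC a (c ≫ u) b' e) (w : d ≫ u = s ≫ e) : IsFPC d u s e :=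
  of_exists_lift (isPullback_of_meetsWithin w
      ((F.meetsWithin_comp_iff e u).1 (.of_isPullback G.isPullback)))
    fun _ z hz => G.exists_lift ((F.meetsWithin_comp_iff z u).2 hz)

theorem exists_of_paste_horiz {E Y : C} {u : X ⟶ Y} {b' : A ⟶ E} {e : E ⟶ Y} [Mono d] [Mono e]
    [Mono u] (F : IsFPC a c b d) (G : IsFPC a (c ≫ u) b' e) :
    ∃ s : D ⟶ E, b ≫ s = b' ∧ IsFPC d u s e := by
  obtain ⟨s, hs⟩ := G.exists_lift (MeetsWithin.of_isPullback (isPullback_comp_mono F.isPullback u))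
  refine ⟨s, ?_, F.of_paste_horiz G hs.symm⟩
  rw [← cancel_mono e, Category.assoc, hs, ← F.isPullback.w_assoc, G.isPullback.w]

theorem paste_vert {A' D' : C} {a' : A' ⟶ A} {b' : A' ⟶ D'} {d' : D' ⟶ D} [Mono a] [Mono d]
    [Mono d'] (F : IsFPC a c b d) (F' : IsFPC a' b b' d') :
    IsFPC (a' ≫ a) c b' (d' ≫ d) := by
  refine of_exists_lift (F'.isPullback.paste_horiz F.isPullback) fun T z hz => ?_
  obtain ⟨z, rfl⟩ := F.exists_lift fun _ p x hp => by
    obtain ⟨l, hl⟩ := hz p x hp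
    exact ⟨l ≫ a', by rw [Category.assoc, hl]⟩
  obtain ⟨z, rfl⟩ := F'.exists_lift (z := z) fun _ p x hp => by
    obtain ⟨l, hl⟩ := hz p (x ≫ a) (by simp [F.isPullback.w, reassoc_of% hp])
    exact ⟨l, by simpa [← cancel_mono a] using hl⟩
  exact ⟨z, by simp⟩

theorem of_isPullback {A' B' D' X' : C} {a' : A' ⟶ B'} {c' : B' ⟶ X'} {b' : A' ⟶ D'} {d' : D' ⟶ X'}
    {α : A' ⟶ A} {β : B' ⟶ B} {δ : D' ⟶ D} {ξ : X' ⟶ X} [Mono a'] [Mono d'] (F : IsFPC a c b d)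
    (hA : IsPullback a' α β a) (hB : IsPullback c' β ξ c) (hD : IsPullback d' δ ξ d)
    (w : a' ≫ c' = b' ≫ d') : IsFPC a' c' b' d' := by
  refine of_exists_lift (isPullback_of_meetsWithin w fun P p x hp => ?_) fun T z hz => ?_
  · obtain ⟨l, hl⟩ := MeetsWithin.of_isPullback F.isPullback (p ≫ δ) (x ≫ β) (by
      rw [Category.assoc, ← hD.w, reassoc_of% hp, Category.assoc, hB.w])
    exact ⟨hA.lift x l hl.symm, hA.lift_fst ..⟩
  · obtain ⟨y, hy⟩ := F.exists_lift (z := z ≫ ξ) fun P p x hp => by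
      obtain ⟨y, hy, rfl⟩ := hB.exists_lift (p ≫ z) x (by simpa using hp)
      obtain ⟨l, rfl⟩ := hz p y hy.symm
      exact ⟨l ≫ α, by simp [hA.w]⟩
    exact ⟨hD.lift z y hy.symm, hD.lift_fst ..⟩

end IsFPC

section Adhesive

variable [Adhesive C]

theorem isPushout_of_isPullback {W X Y Z W' X' Y' Z' : C} {f : W ⟶ X} {g : W ⟶ Y} {h : X ⟶ Z}
    {i : Y ⟶ Z} [Mono f] (H : IsPushout f g h i) {f' : W' ⟶ X'} {g' : W' ⟶ Y'} {h' : X' ⟶ Z'}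
    {i' : Y' ⟶ Z'} {αW : W' ⟶ W} {αX : X' ⟶ X} {αY : Y' ⟶ Y} {αZ : Z' ⟶ Z}
    (hX : IsPullback h' αX αZ h) (hY : IsPullback i' αY αZ i) (hf : IsPullback f' αW αX f)
    (w : f' ≫ h' = g' ≫ i') (wg : g' ≫ αY = αW ≫ g) : IsPushout f' g' h' i' := by
  have hg : IsPullback g' αW αY g := by
    refine IsPullback.of_right ?_ wg hY
    rw [← w, ← H.w]
    exact hf.paste_horiz hX
  exact ((Adhesive.van_kampen H) f' g' h' i' αW αX αY αZ hf hg hX.toCommSq hY.toCommSq ⟨w⟩).2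
    ⟨hX, hY⟩

theorem exists_mono_desc {W X Y P Z : C} {f : W ⟶ X} {g : W ⟶ Y} {h : X ⟶ P} {i : Y ⟶ P}
    {x : X ⟶ Z} {y : Y ⟶ Z} [Mono x] [Mono y] (hP : IsPushout f g h i) (H : IsPullback f g x y) :
    ∃ u : P ⟶ Z, Mono u ∧ h ≫ u = x ∧ i ≫ u = y := by
  obtain ⟨u, hx, hy⟩ := hP.exists_desc x y H.w
  refine ⟨u, ?_, hx, hy⟩
  have hQ : IsPushout f g (pushout.inl (pullback.fst x y) (pullback.snd x y)) (pushout.inr _ _) :=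
    (IsPushout.of_hasPushout _ _).of_iso H.isoPullback.symm (Iso.refl _) (Iso.refl _)
      (Iso.refl _) (by simp) (by simp) (by simp) (by simp)
  have := Adhesive.desc_mono_of_mono (a := x) (b := y)
  have hu : (hP.isoIsPushout _ _ hQ).hom ≫ pushout.desc x y pullback.condition = u := by
    apply hP.hom_ext
    · rw [hP.inl_isoIsPushout_hom_assoc, pushout.inl_desc, hx]
    · rw [hP.inr_isoIsPushout_hom_assoc, pushout.inr_desc, hy]
  exact hu ▸ mono_comp _ _

theorem isPushout_of_isPullback_of_cover {W X Y Z : C} {f : W ⟶ X} {g : W ⟶ Y} {h : X ⟶ Z}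
    {i : Y ⟶ Z} [Mono f] [Mono h] [Mono i] (H : IsPullback f g h i)
    (hD : ∀ ⦃D : C⦄ (d : D ⟶ Z) [Mono d], (∃ x, x ≫ d = h) → (∃ y, y ≫ d = i) →
      ∃ l, l ≫ d = 𝟙 Z) : IsPushout f g h i := by
  have hP := IsPushout.of_hasPushout f g
  obtain ⟨d, _, hx, hy⟩ := exists_mono_desc hP H
  obtain ⟨l, hl⟩ := hD d ⟨_, hx⟩ ⟨_, hy⟩
  have : IsIso d := ⟨l, by rw [← cancel_mono d]; simp [hl], hl⟩
  exact hP.of_iso (Iso.refl _) (Iso.refl _) (Iso.refl _) (asIso d) (by simp) (by simp)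
    (by simp [hx]) (by simp [hy])

theorem exists_isPushout_of_isPushout_comp_mono {W X Y Z' Z : C} {f : W ⟶ X} {g : W ⟶ Y}
    {h : X ⟶ Z'} {u : Z' ⟶ Z} {i : Y ⟶ Z} [Mono f] [Mono u] (H : IsPushout f g (h ≫ u) i) :
    ∃ (Y' : C) (g' : W ⟶ Y') (i' : Y' ⟶ Z'), IsPushout f g' h i' := by
  have hY := IsPullback.of_hasPullback u i
  exact ⟨_, hY.lift (f ≫ h) g (by simpa using H.w), _, isPushout_of_isPullback H
    (isPullback_id_of_mono h u) hY IsPullback.of_id_snd (by simp) (by simp)⟩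

variable [HasPullbacks C]

theorem exists_lift_of_isPushout {W X Y Z T D E : C} {f : W ⟶ X} {g : W ⟶ Y} {h : X ⟶ Z}
    {i : Y ⟶ Z} [Mono f] (H : IsPushout f g h i) (z : T ⟶ Z) {e : T ⟶ E} (d : D ⟶ E) [Mono d]
    (hX : ∀ ⦃P : C⦄ (p : P ⟶ T) (x : P ⟶ X), p ≫ z = x ≫ h → ∃ l, l ≫ d = p ≫ e)
    (hY : ∀ ⦃P : C⦄ (p : P ⟶ T) (y : P ⟶ Y), p ≫ z = y ≫ i → ∃ l, l ≫ d = p ≫ e) :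
    ∃ l, l ≫ d = e := by
  have sX := IsPullback.of_hasPullback z h
  have sY := IsPullback.of_hasPullback z i
  obtain ⟨_, _, _, _, _, _, H'⟩ := (Adhesive.van_kampen H).exists_cube_filling sX sY
  exact exists_lift_of_isPushout_of_legs H' d (hX _ _ sX.w) (hY _ _ sY.w)

theorem isFPC_of_isPushout {W X Y Z : C} {f : W ⟶ X} {g : W ⟶ Y} {h : X ⟶ Z} {i : Y ⟶ Z} [Mono f]
    (H : IsPushout f g h i) : IsFPC f h g i := by
  have : Mono i := Adhesive.mono_of_isPushout_of_mono_left H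
  refine .of_exists_lift (Adhesive.isPullback_of_isPushout_of_mono_left H) fun T z hz =>
    exists_lift_of_isPushout H z i (fun P p x hp => ?_) fun P p y hp => ⟨y, hp.symm⟩
  obtain ⟨l, rfl⟩ := hz p x hp
  exact ⟨l ≫ g, by rw [hp, Category.assoc, Category.assoc, H.w]⟩

theorem exists_isPushout_of_comp_mono {W X Y Y' Z Z' : C} {f : W ⟶ X} {g : W ⟶ Y} {h : X ⟶ Z'}
    {u : Z' ⟶ Z} {i : Y ⟶ Z} {g' : W ⟶ Y'} {i' : Y' ⟶ Z'} [Mono f] [Mono u]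
    (H : IsPushout f g (h ≫ u) i) (H' : IsPushout f g' h i') :
    ∃ t : Y' ⟶ Y, g' ≫ t = g ∧ IsPushout i' t u i := by
  have : Mono i := Adhesive.mono_of_isPushout_of_mono_left H
  have : Mono i' := Adhesive.mono_of_isPushout_of_mono_left H'
  obtain ⟨t, rfl, F⟩ := (isFPC_of_isPushout H').exists_of_paste_horiz (isFPC_of_isPushout H)
  exact ⟨t, rfl, H.of_top F.isPullback.w H'⟩

theorem exists_isPushout_of_mono_comp {V W X Y Y' Z : C} {f : V ⟶ W} {f' : W ⟶ X} {g : V ⟶ Y}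
    {h : X ⟶ Z} {i : Y ⟶ Z} {s : W ⟶ Y'} {a : Y' ⟶ Z} [Mono f] [Mono f']
    (H : IsPushout (f ≫ f') g h i) (H' : IsPushout f' s h a) :
    ∃ r : Y ⟶ Y', r ≫ a = i ∧ IsPushout f g s r := by
  have : Mono a := Adhesive.mono_of_isPushout_of_mono_left H'
  have hi : MeetsWithin i h (f ≫ f') :=
    .of_isPullback (Adhesive.isPullback_of_isPushout_of_mono_left H)
  obtain ⟨r, rfl⟩ := (isFPC_of_isPushout H').exists_lift fun P p x hp => by
    obtain ⟨l, hl⟩ := hi p x hp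
    exact ⟨l ≫ f, by simpa using hl⟩
  refine ⟨r, rfl, isPushout_of_isPullback H
    (Adhesive.isPullback_of_isPushout_of_mono_left H').flip (isPullback_id_of_mono r a)
    (isPullback_id_of_mono f f') ?_ (by simp)⟩
  rw [← cancel_mono a, Category.assoc, Category.assoc, ← H'.w, ← H.w, Category.assoc]

section Cube

variable {P Y X D K N : C} {f : P ⟶ D} {f' : P ⟶ Y} {d : D ⟶ X} {y : Y ⟶ X} [Mono d]

theorem exists_isPushout_isPullback_of_cube {B L : C} {s : D ⟶ K} {v : X ⟶ N} {b : K ⟶ N}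
    {g : P ⟶ B} {r : B ⟶ K} {j : Y ⟶ L} {h : B ⟶ L} (hP : IsPullback f f' d y)
    (H : IsPushout d s v b) (Hf : IsPushout f g s r) (Hf' : IsPushout f' g j h) :
    ∃ o : L ⟶ N, h ≫ o = r ≫ b ∧ IsPushout y j v o ∧ IsPullback r h b o := by
  have : Mono f' := hP.mono_snd_of_mono
  have : Mono b := Adhesive.mono_of_isPushout_of_mono_left H
  have : Mono h := Adhesive.mono_of_isPushout_of_mono_left Hf'
  have hb : MeetsWithin b v d :=
    .of_isPullback (Adhesive.isPullback_of_isPushout_of_mono_left H)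
  have HN := Hf.paste_horiz H
  rw [hP.w] at HN
  obtain ⟨o, ho, HL⟩ : ∃ o, h ≫ o = r ≫ b ∧ IsPushout y j v o :=
    ⟨_, Hf'.inr_desc _ _ (by simpa using HN.w), HN.of_left' Hf'⟩
  refine ⟨o, ho, HL, (isPullback_of_meetsWithin ho fun T q x hx => ?_).flip⟩
  refine exists_lift_of_isPushout Hf' x h (fun Q p q' hq => ?_) fun Q p q' hq => ⟨q', hq.symm⟩
  obtain ⟨l, hl⟩ := hb (p ≫ q) (q' ≫ y) (by
    rw [Category.assoc, hx, reassoc_of% hq, Category.assoc, HL.w])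
  exact ⟨hP.lift l q' hl ≫ g, by simp [← Hf'.w, hq]⟩

theorem exists_isFPC_isPushout_of_cube {Q L : C} {u : X ⟶ N} {w : D ⟶ Q} {ι : Q ⟶ N} {t : Y ⟶ K}
    {a : K ⟶ N} {l₁ : L ⟶ Q} {l₂ : L ⟶ K} [Mono y] [Mono ι] (hP : IsPullback f f' d y)
    (F : IsFPC d u w ι) (H : IsPushout y t u a) (hL : IsPullback l₁ l₂ ι a) :
    ∃ k : P ⟶ L, IsFPC f' t k l₂ ∧ IsPushout f k w l₁ := by
  have : Mono f' := hP.mono_snd_of_mono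
  have : Mono l₂ := hL.mono_snd_of_mono
  obtain ⟨k, hk₁, hk₂⟩ := hL.exists_lift (f ≫ w) (f' ≫ t) (by
    rw [Category.assoc, ← F.isPullback.w, hP.w_assoc, H.w, Category.assoc])
  exact ⟨k, F.of_isPullback hP.flip (Adhesive.isPullback_of_isPushout_of_mono_left H).flip hL.flip
    hk₂.symm, isPushout_of_isPullback H F.isPullback.flip hL hP hk₁.symm hk₂⟩

end Cube

end Adhesive

theorem LinearProduction.IsIsomorphic.trans {p q r : LinearProduction C} (h : p.IsIsomorphic q)
    (h' : q.IsIsomorphic r) : p.IsIsomorphic r := by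
  obtain ⟨eO, eK, eI, ho, hi⟩ := h
  obtain ⟨fO, fK, fI, ho', hi'⟩ := h'
  exact ⟨eO ≪≫ fO, eK ≪≫ fK, eI ≪≫ fI, by simp [reassoc_of% ho, ho'],
    by simp [reassoc_of% hi, hi']⟩

namespace CompositionDiagram

section Mono

variable [Adhesive C] {p₂ p₁ : LinearProduction C} {m : Overlap p₂ p₁} (D : CompositionDiagram m)

instance : Mono D.n₂ := Adhesive.mono_of_isPushout_of_mono_right D.isPushout_N
instance : Mono D.n₁ := Adhesive.mono_of_isPushout_of_mono_left D.isPushout_N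
instance : Mono D.o₁' := Adhesive.mono_of_isPushout_of_mono_left D.isPushout_complement
instance : Mono D.i₁' := Adhesive.mono_of_isPushout_of_mono_left D.isPushout_I
instance : Mono D.o₂' := Adhesive.mono_of_isPushout_of_mono_left D.isPushout_O
instance : Mono D.i₂'' := D.isPullback_K.mono_fst_of_mono
instance : Mono D.k₁ := mono_of_mono_fac D.isPushout_complement.w.symm
instance : Mono D.nstar₁ := Adhesive.mono_of_isPushout_of_mono_right D.isPushout_I

variable [HasMonoFPCs C]

instance : Mono D.i₂' := (HasMonoFPCs.mono_of_isFPC D.isFPC).2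
instance : Mono D.k₂ := (HasMonoFPCs.mono_of_isFPC D.isFPC).1
instance : Mono D.nstar₂ := Adhesive.mono_of_isPushout_of_mono_right D.isPushout_O
instance : Mono D.o₁'' := D.isPullback_K.mono_snd_of_mono

end Mono

theorem isIsomorphic_composite [HasPullbacks C] [Adhesive C] [HasMonoFPCs C]
    {p₂ p₁ : LinearProduction C} {m : Overlap p₂ p₁} (D D' : CompositionDiagram m) :
    D.composite.IsIsomorphic D'.composite := by
  let e := D.isPushout_N.isoIsPushout _ _ D'.isPushout_N
  obtain ⟨k₁, hk₁, hk₁'⟩ := (isFPC_of_isPushout D.isPushout_complement).exists_iso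
    (isFPC_of_isPushout D'.isPushout_complement) e (by simp [e])
  obtain ⟨k₂, hk₂, hk₂'⟩ := D.isFPC.exists_iso D'.isFPC e (by simp [e])
  have hI : IsPushout p₁.i D.k₁ D'.nstar₁ (k₁.hom ≫ D'.i₁') :=
    D'.isPushout_I.of_iso (Iso.refl _) (Iso.refl _) k₁.symm (Iso.refl _) (by simp)
      (by simp [← hk₁']) (by simp) (by simp)
  have hO : IsPushout p₂.o D.k₂ D'.nstar₂ (k₂.hom ≫ D'.o₂') :=
    D'.isPushout_O.of_iso (Iso.refl _) (Iso.refl _) k₂.symm (Iso.refl _) (by simp)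
      (by simp [← hk₂']) (by simp) (by simp)
  have hK : IsPullback (D.i₂'' ≫ k₂.hom) (D.o₁'' ≫ k₁.hom) D'.i₂' D'.o₁' :=
    D.isPullback_K.of_iso (Iso.refl _) k₂ k₁ e (by simp) (by simp) hk₂.symm hk₁.symm
  refine ⟨D.isPushout_O.isoIsPushout _ _ hO, hK.isoIsPullback _ _ D'.isPullback_K,
    D.isPushout_I.isoIsPushout _ _ hI, ?_, ?_⟩
  · simp [composite]
  · simp [composite]

end CompositionDiagram

variable {p₁ p₂ p₃ : LinearProduction C}

section

variable {m₂₁ : Overlap p₂ p₁} {m₃₂ : Overlap p₃ p₂}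

/-- The common refinement of two nested compositions of `p₃`, `p₂` and `p₁`. Here `N` is the middle
object of the composition of `p₃` with the composite of `p₂` and `p₁`, and `X` is the middle object
of the composition of the composite of `p₃` and `p₂` with `p₁`. The context `K` of `p₂` in both of
them glues the one in `D₂₁` with the one in `D₃₂`. -/
structure AssocDiagram (D₂₁ : CompositionDiagram m₂₁) (D₃₂ : CompositionDiagram m₃₂) {N X : C}
    (n₃ : p₃.I ⟶ N) (n₂₁ : D₂₁.O₂₁ ⟶ N) (x₃₂ : D₃₂.I₂₁ ⟶ X) (x₁ : p₁.O ⟶ X) where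
  K : C
  s : D₂₁.Kbar₂ ⟶ K
  t : D₃₂.Kbar₁ ⟶ K
  a : K ⟶ N
  b : K ⟶ X
  u : D₃₂.N ⟶ N
  v : D₂₁.N ⟶ X
  isPushout_u_a : IsPushout D₃₂.o₁' t u a
  isPushout_v_b : IsPushout D₂₁.i₂' s v b
  n₂_u : D₃₂.n₂ ≫ u = n₃
  n₁_u : D₃₂.n₁ ≫ u = D₂₁.nstar₂ ≫ n₂₁
  n₂_v : D₂₁.n₂ ≫ v = D₃₂.nstar₁ ≫ x₃₂
  n₁_v : D₂₁.n₁ ≫ v = x₁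
  k₂_s : D₂₁.k₂ ≫ s = D₃₂.k₁ ≫ t
  s_a : s ≫ a = D₂₁.o₂' ≫ n₂₁
  t_b : t ≫ b = D₃₂.i₁' ≫ x₃₂

namespace AssocDiagram

variable {D₂₁ : CompositionDiagram m₂₁} {D₃₂ : CompositionDiagram m₃₂}

section Transport

variable {N X N' X' : C} {n₃ : p₃.I ⟶ N} {n₂₁ : D₂₁.O₂₁ ⟶ N} {x₃₂ : D₃₂.I₂₁ ⟶ X} {x₁ : p₁.O ⟶ X}
  {n₃' : p₃.I ⟶ N'} {n₂₁' : D₂₁.O₂₁ ⟶ N'} {x₃₂' : D₃₂.I₂₁ ⟶ X'} {x₁' : p₁.O ⟶ X'}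

/-- Transport of a common refinement along isomorphisms of the two middle objects. -/
def ofIso (A : AssocDiagram D₂₁ D₃₂ n₃ n₂₁ x₃₂ x₁) (e : N ≅ N') (f : X ≅ X')
    (h₃ : n₃ ≫ e.hom = n₃') (h₂₁ : n₂₁ ≫ e.hom = n₂₁') (h₃₂ : x₃₂ ≫ f.hom = x₃₂')
    (h₁ : x₁ ≫ f.hom = x₁') : AssocDiagram D₂₁ D₃₂ n₃' n₂₁' x₃₂' x₁' where
  K := A.K
  s := A.s
  t := A.t
  a := A.a ≫ e.hom
  b := A.b ≫ f.hom
  u := A.u ≫ e.hom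
  v := A.v ≫ f.hom
  isPushout_u_a := A.isPushout_u_a.of_iso (Iso.refl _) (Iso.refl _) (Iso.refl _) e (by simp)
    (by simp) (by simp) (by simp)
  isPushout_v_b := A.isPushout_v_b.of_iso (Iso.refl _) (Iso.refl _) (Iso.refl _) f (by simp)
    (by simp) (by simp) (by simp)
  n₂_u := by rw [← h₃, reassoc_of% A.n₂_u]
  n₁_u := by rw [← h₂₁, reassoc_of% A.n₁_u]
  n₂_v := by rw [← h₃₂, reassoc_of% A.n₂_v]
  n₁_v := by rw [← h₁, reassoc_of% A.n₁_v]
  k₂_s := A.k₂_s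
  s_a := by rw [← h₂₁, reassoc_of% A.s_a]
  t_b := by rw [← h₃₂, reassoc_of% A.t_b]

end Transport

variable {N X : C} {n₃ : p₃.I ⟶ N} {n₂₁ : D₂₁.O₂₁ ⟶ N} {x₃₂ : D₃₂.I₂₁ ⟶ X} {x₁ : p₁.O ⟶ X}

theorem isPushout_n₂₁_a (A : AssocDiagram D₂₁ D₃₂ n₃ n₂₁ x₃₂ x₁) :
    IsPushout D₂₁.o₂' A.s n₂₁ A.a := by
  have h := D₃₂.isPushout_complement.paste_vert A.isPushout_u_a
  rw [A.n₁_u, ← A.k₂_s] at h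
  exact h.of_top A.s_a.symm D₂₁.isPushout_O

variable [Adhesive C]

instance (A : AssocDiagram D₂₁ D₃₂ n₃ n₂₁ x₃₂ x₁) : Mono A.a :=
  Adhesive.mono_of_isPushout_of_mono_left A.isPushout_u_a

theorem isPullback_u_a (A : AssocDiagram D₂₁ D₃₂ n₃ n₂₁ x₃₂ x₁) : IsPullback D₃₂.o₁' A.t A.u A.a :=
  Adhesive.isPullback_of_isPushout_of_mono_left A.isPushout_u_a

theorem isPullback_n₂₁_a (A : AssocDiagram D₂₁ D₃₂ n₃ n₂₁ x₃₂ x₁) :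
    IsPullback D₂₁.o₂' A.s n₂₁ A.a :=
  Adhesive.isPullback_of_isPushout_of_mono_left A.isPushout_n₂₁_a

instance [Mono n₂₁] (A : AssocDiagram D₂₁ D₃₂ n₃ n₂₁ x₃₂ x₁) : Mono A.s := mono_of_mono_fac A.s_a
instance [Mono x₃₂] (A : AssocDiagram D₂₁ D₃₂ n₃ n₂₁ x₃₂ x₁) : Mono A.t := mono_of_mono_fac A.t_b
instance [Mono x₃₂] (A : AssocDiagram D₂₁ D₃₂ n₃ n₂₁ x₃₂ x₁) : Mono A.u :=
  Adhesive.mono_of_isPushout_of_mono_right A.isPushout_u_a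
instance [Mono n₂₁] (A : AssocDiagram D₂₁ D₃₂ n₃ n₂₁ x₃₂ x₁) : Mono A.v :=
  Adhesive.mono_of_isPushout_of_mono_right A.isPushout_v_b

instance [HasMonoFPCs C] (A : AssocDiagram D₂₁ D₃₂ n₃ n₂₁ x₃₂ x₁) : Mono A.b :=
  Adhesive.mono_of_isPushout_of_mono_left A.isPushout_v_b

theorem isPullback_v_b [HasMonoFPCs C] (A : AssocDiagram D₂₁ D₃₂ n₃ n₂₁ x₃₂ x₁) :
    IsPullback D₂₁.i₂' A.s A.v A.b :=
  Adhesive.isPullback_of_isPushout_of_mono_left A.isPushout_v_b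

theorem isPullback_m₃₂ (A : AssocDiagram D₂₁ D₃₂ n₃ n₂₁ x₃₂ x₁)
    [Mono x₃₂] : IsPullback m₃₂.m₂ m₃₂.m₁ n₃ (D₂₁.nstar₂ ≫ n₂₁) := by
  simpa only [A.n₁_u, A.n₂_u] using isPullback_comp_mono
    (Adhesive.isPullback_of_isPushout_of_mono_left D₃₂.isPushout_N) A.u

theorem isPullback_m₂₁ (A : AssocDiagram D₂₁ D₃₂ n₃ n₂₁ x₃₂ x₁)
    [Mono n₂₁] : IsPullback m₂₁.m₂ m₂₁.m₁ (D₃₂.nstar₁ ≫ x₃₂) x₁ := by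
  simpa only [A.n₁_v, A.n₂_v] using isPullback_comp_mono
    (Adhesive.isPullback_of_isPushout_of_mono_left D₂₁.isPushout_N) A.v

variable [HasPullbacks C]

theorem isPushout_x₃₂_x₁ (A : AssocDiagram D₂₁ D₃₂ n₃ n₂₁ x₃₂ x₁)
    [Mono x₃₂] [Mono x₁] {M M' : C} {l₃ : M ⟶ p₃.I} {l₂₁ : M ⟶ D₂₁.O₂₁}
    [Mono l₃] (H : IsPushout l₃ l₂₁ n₃ n₂₁) {l₃₂ : M' ⟶ D₃₂.I₂₁} {l₁ : M' ⟶ p₁.O} [Mono l₃₂]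
    (H' : IsPullback l₃₂ l₁ x₃₂ x₁) : IsPushout l₃₂ l₁ x₃₂ x₁ := by
  refine isPushout_of_isPullback_of_cover H' fun D d _ ⟨x, hx⟩ ⟨y, hy⟩ => ?_
  have hv : ∃ v', v' ≫ d = A.v := exists_lift_of_isPushout_of_legs D₂₁.isPushout_N d
    ⟨D₃₂.nstar₁ ≫ x, by rw [Category.assoc, hx, A.n₂_v]⟩ ⟨y, by rw [hy, A.n₁_v]⟩
  obtain ⟨v', hv⟩ := hv
  have hb : ∃ b', b' ≫ d = A.b := exists_lift_of_isPushout H A.a d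
    (fun P p q hq => ⟨A.isPullback_u_a.lift (q ≫ D₃₂.n₂) p (by simp [A.n₂_u, hq]) ≫ D₃₂.i₁' ≫ x,
      by simp [hx, ← A.t_b]⟩)
    (fun P p q hq => ⟨A.isPullback_n₂₁_a.lift q p hq.symm ≫ D₂₁.i₂' ≫ v',
      by simp [hv, A.isPushout_v_b.w]⟩)
  simpa using exists_lift_of_isPushout_of_legs A.isPushout_v_b (e := 𝟙 X) d
    (by simpa using ⟨v', hv⟩) (by simpa using hb)

theorem exists_hom_x (A : AssocDiagram D₂₁ D₃₂ n₃ n₂₁ x₃₂ x₁)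
    {X' : C} {x₃₂' : D₃₂.I₂₁ ⟶ X'} {x₁' : p₁.O ⟶ X'}
    (A' : AssocDiagram D₂₁ D₃₂ n₃ n₂₁ x₃₂' x₁') :
    ∃ f : X ⟶ X', x₃₂ ≫ f = x₃₂' ∧ x₁ ≫ f = x₁' := by
  obtain ⟨e, ⟨ha, hs⟩, -⟩ := (isFPC_of_isPushout A.isPushout_n₂₁_a).existsUnique_hom
    (isFPC_of_isPushout A'.isPushout_n₂₁_a) (Iso.refl N) (Category.comp_id _)
  have hu : A.u = A'.u := D₃₂.isPushout_N.hom_ext (by rw [A.n₂_u, A'.n₂_u])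
    (by rw [A.n₁_u, A'.n₁_u])
  have ht : A.t ≫ e = A'.t := by
    rw [← cancel_mono A'.a, ← A'.isPushout_u_a.w, ← hu, A.isPushout_u_a.w]
    simp [ha]
  obtain ⟨f, hv, hb⟩ := A.isPushout_v_b.exists_desc A'.v (e ≫ A'.b)
    (by rw [A'.isPushout_v_b.w, reassoc_of% hs])
  refine ⟨f, D₃₂.isPushout_I.hom_ext ?_ ?_, by rw [← A.n₁_v, Category.assoc, hv, A'.n₁_v]⟩
  · rw [← reassoc_of% A.n₂_v, hv, A'.n₂_v]
  · rw [← reassoc_of% A.t_b, hb, reassoc_of% ht, A'.t_b]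

variable [HasMonoFPCs C]

theorem isFPC_x₃₂_b (A : AssocDiagram D₂₁ D₃₂ n₃ n₂₁ x₃₂ x₁) : IsFPC D₃₂.i₁' x₃₂ A.t A.b := by
  have F := D₂₁.isFPC.paste_horiz (isFPC_of_isPushout A.isPushout_v_b)
  rw [A.n₂_v, A.k₂_s] at F
  exact (isFPC_of_isPushout D₃₂.isPushout_I).of_paste_horiz F A.t_b.symm

theorem isPushout_n₃_n₂₁ (A : AssocDiagram D₂₁ D₃₂ n₃ n₂₁ x₃₂ x₁)
    [Mono n₃] [Mono n₂₁] {M M' : C} {l₃ : M ⟶ p₃.I} {l₂₁ : M ⟶ D₂₁.O₂₁}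
    [Mono l₃] (H : IsPullback l₃ l₂₁ n₃ n₂₁) {l₃₂ : M' ⟶ D₃₂.I₂₁} {l₁ : M' ⟶ p₁.O} [Mono l₃₂]
    (H' : IsPushout l₃₂ l₁ x₃₂ x₁) : IsPushout l₃ l₂₁ n₃ n₂₁ := by
  refine isPushout_of_isPullback_of_cover H fun D d _ ⟨x, hx⟩ ⟨y, hy⟩ => ?_
  have hu : ∃ u', u' ≫ d = A.u := exists_lift_of_isPushout_of_legs D₃₂.isPushout_N d
    ⟨x, by rw [hx, A.n₂_u]⟩ ⟨D₂₁.nstar₂ ≫ y, by rw [Category.assoc, hy, A.n₁_u]⟩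
  obtain ⟨u', hu⟩ := hu
  have ha : ∃ a', a' ≫ d = A.a := exists_lift_of_isPushout H' A.b d
    (fun P p q hq => ⟨A.isFPC_x₃₂_b.isPullback.lift q p hq.symm ≫ D₃₂.o₁' ≫ u',
      by simp [hu, A.isPushout_u_a.w]⟩)
    (fun P p q hq => ⟨A.isPullback_v_b.lift (q ≫ D₂₁.n₁) p (by simp [A.n₁_v, hq]) ≫ D₂₁.o₂' ≫ y,
      by simp [hy, ← A.s_a]⟩)
  simpa using exists_lift_of_isPushout_of_legs A.isPushout_u_a (e := 𝟙 N) d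
    (by simpa using ⟨u', hu⟩) (by simpa using ha)

theorem exists_complement_x₁ (A : AssocDiagram D₂₁ D₃₂ n₃ n₂₁ x₃₂ x₁)
    {B : C} {g : D₂₁.K₂₁ ⟶ B} {ω : B ⟶ N}
    (G : IsPushout (D₂₁.i₂'' ≫ D₂₁.o₂') g n₂₁ ω) :
    ∃ (L : C) (j : D₂₁.Kbar₁ ⟶ L) (h : B ⟶ L) (r : B ⟶ A.K) (o : L ⟶ X), r ≫ A.a = ω ∧
      IsPushout D₂₁.o₁'' g j h ∧ IsPushout p₁.o (D₂₁.k₁ ≫ j) x₁ o ∧ IsPullback r h A.b o := by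
  obtain ⟨r, hr, Hr⟩ := exists_isPushout_of_mono_comp G A.isPushout_n₂₁_a
  have HL := IsPushout.of_hasPushout D₂₁.o₁'' g
  obtain ⟨o, -, Ho, Hb⟩ :=
    exists_isPushout_isPullback_of_cube D₂₁.isPullback_K A.isPushout_v_b Hr HL
  exact ⟨_, _, _, r, o, hr, HL, A.n₁_v ▸ D₂₁.isPushout_complement.paste_vert Ho, Hb⟩

theorem exists_complement_n₂₁ (A : AssocDiagram D₂₁ D₃₂ n₃ n₂₁ x₃₂ x₁)
    [Mono n₂₁] {L : C} {k : p₁.K ⟶ L} {o : L ⟶ X} (G : IsPushout p₁.o k x₁ o) :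
    ∃ (B : C) (g : D₂₁.K₂₁ ⟶ B) (ω : B ⟶ N), IsPushout (D₂₁.i₂'' ≫ D₂₁.o₂') g n₂₁ ω := by
  rw [← A.n₁_v] at G
  obtain ⟨j, -, Hj⟩ := exists_isPushout_of_comp_mono G D₂₁.isPushout_complement
  have hB := IsPullback.of_hasPullback A.b o
  obtain ⟨g, hg, hg'⟩ := hB.exists_lift (D₂₁.i₂'' ≫ A.s) (D₂₁.o₁'' ≫ j) (by
    simp [← A.isPushout_v_b.w, D₂₁.isPullback_K.w_assoc, Hj.w])
  have Hg := isPushout_of_isPullback Hj A.isPullback_v_b.flip hB D₂₁.isPullback_K hg.symm hg'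
  exact ⟨_, g, _, Hg.paste_horiz A.isPushout_n₂₁_a⟩

theorem exists_hom_n (A : AssocDiagram D₂₁ D₃₂ n₃ n₂₁ x₃₂ x₁)
    {N' : C} {n₃' : p₃.I ⟶ N'} {n₂₁' : D₂₁.O₂₁ ⟶ N'}
    (A' : AssocDiagram D₂₁ D₃₂ n₃' n₂₁' x₃₂ x₁) :
    ∃ f : N ⟶ N', n₃ ≫ f = n₃' ∧ n₂₁ ≫ f = n₂₁' := by
  obtain ⟨e, ⟨hb, ht⟩, -⟩ := A.isFPC_x₃₂_b.existsUnique_hom A'.isFPC_x₃₂_b (Iso.refl X)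
    (Category.comp_id _)
  have hv : A.v = A'.v := D₂₁.isPushout_N.hom_ext (by rw [A.n₂_v, A'.n₂_v])
    (by rw [A.n₁_v, A'.n₁_v])
  have hs : A.s ≫ e = A'.s := by
    rw [← cancel_mono A'.b, ← A'.isPushout_v_b.w, ← hv, A.isPushout_v_b.w]
    simp [hb]
  obtain ⟨f, hu, ha⟩ := A.isPushout_u_a.exists_desc A'.u (e ≫ A'.a)
    (by rw [A'.isPushout_u_a.w, reassoc_of% ht])
  refine ⟨f, by rw [← A.n₂_u, Category.assoc, hu, A'.n₂_u], D₂₁.isPushout_O.hom_ext ?_ ?_⟩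
  · rw [← reassoc_of% A.n₁_u, hu, A'.n₁_u]
  · rw [← reassoc_of% A.s_a, ha, reassoc_of% hs, A'.s_a]

variable (D₃₂) in
theorem exists_of_isPullback_n {K : C} {s : D₂₁.Kbar₂ ⟶ K} {a : K ⟶ N} [Mono n₃] [Mono n₂₁]
    (G : IsPushout D₂₁.o₂' s n₂₁ a) (H : IsPullback m₃₂.m₂ m₃₂.m₁ n₃ (D₂₁.nstar₂ ≫ n₂₁)) :
    ∃ (X : C) (x₃₂ : D₃₂.I₂₁ ⟶ X) (x₁ : p₁.O ⟶ X), Mono x₃₂ ∧ Mono x₁ ∧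
      Nonempty (AssocDiagram D₂₁ D₃₂ n₃ n₂₁ x₃₂ x₁) := by
  have : Mono s := mono_of_mono_fac G.w.symm
  obtain ⟨u, _, hu₂, hu₁⟩ := exists_mono_desc D₃₂.isPushout_N H
  have hK := D₂₁.isPushout_O.paste_vert G
  rw [← hu₁] at hK
  obtain ⟨t, ht, Ga⟩ := exists_isPushout_of_comp_mono hK D₃₂.isPushout_complement
  have : Mono t := mono_of_mono_fac Ga.w.symm
  have Gb := IsPushout.of_hasPushout D₂₁.i₂' s
  have : Mono (pushout.inl D₂₁.i₂' s) := Adhesive.mono_of_isPushout_of_mono_right Gb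
  have : Mono (pushout.inr D₂₁.i₂' s) := Adhesive.mono_of_isPushout_of_mono_left Gb
  have hX : IsPullback p₂.i D₃₂.k₁ (D₂₁.n₂ ≫ pushout.inl D₂₁.i₂' s)
      (t ≫ pushout.inr D₂₁.i₂' s) := by
    refine isPullback_of_comp_mono ?_
    rw [ht]
    exact (D₂₁.isFPC.isPullback.flip.paste_horiz
      (Adhesive.isPullback_of_isPushout_of_mono_left Gb).flip).flip
  obtain ⟨x₃₂, _, hx, hx'⟩ := exists_mono_desc D₃₂.isPushout_I hX
  exact ⟨_, x₃₂, D₂₁.n₁ ≫ pushout.inl D₂₁.i₂' s, inferInstance, inferInstance,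
    ⟨K, s, t, a, _, u, _, Ga, Gb, hu₂, hu₁, hx.symm, rfl, ht.symm, G.w.symm, hx'.symm⟩⟩

variable (D₂₁) in
theorem exists_of_isPullback_x {M : C} {l₃₂ : M ⟶ D₃₂.I₂₁} {l₁ : M ⟶ p₁.O} [Mono x₃₂] [Mono x₁]
    (G : IsPushout l₃₂ l₁ x₃₂ x₁)
    (H : IsPullback m₂₁.m₂ m₂₁.m₁ (D₃₂.nstar₁ ≫ x₃₂) x₁) :
    ∃ (N : C) (n₃ : p₃.I ⟶ N) (n₂₁ : D₂₁.O₂₁ ⟶ N), Mono n₃ ∧ Mono n₂₁ ∧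
      Nonempty (AssocDiagram D₂₁ D₃₂ n₃ n₂₁ x₃₂ x₁) := by
  obtain ⟨K, t, b, F⟩ := HasMonoFPCs.exists_isFPC D₃₂.i₁' x₃₂
  obtain ⟨_, _⟩ := HasMonoFPCs.mono_of_isFPC F
  obtain ⟨v, _, hv₂, hv₁⟩ := exists_mono_desc D₂₁.isPushout_N H
  have F' := (isFPC_of_isPushout D₃₂.isPushout_I).paste_horiz F
  rw [← hv₂] at F'
  obtain ⟨s, hs, Fs⟩ := D₂₁.isFPC.exists_of_paste_horiz F'
  have Gb : IsPushout D₂₁.i₂' s v b := by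
    refine isPushout_of_isPullback_of_cover Fs.isPullback fun D d _ ⟨x, hx⟩ ⟨y, hy⟩ => ?_
    have hx₃₂ : ∃ l, l ≫ d = x₃₂ := exists_lift_of_isPushout_of_legs D₃₂.isPushout_I d
      ⟨D₂₁.n₂ ≫ x, by rw [Category.assoc, hx, hv₂]⟩
      ⟨t ≫ y, by rw [Category.assoc, hy, F.isPullback.w]⟩
    have hx₁ : ∃ l, l ≫ d = x₁ := ⟨D₂₁.n₁ ≫ x, by rw [Category.assoc, hx, hv₁]⟩
    exact exists_lift_of_isPushout_of_legs G d (by simpa using hx₃₂) (by simpa using hx₁)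
  have Ga := IsPushout.of_hasPushout D₃₂.o₁' t
  have : Mono (pushout.inl D₃₂.o₁' t) := Adhesive.mono_of_isPushout_of_mono_right Ga
  obtain ⟨n₂₁, hn, hn'⟩ := D₂₁.isPushout_O.exists_desc (D₃₂.n₁ ≫ pushout.inl D₃₂.o₁' t)
    (s ≫ pushout.inr D₃₂.o₁' t) (by
      rw [D₃₂.isPushout_complement.w_assoc, Ga.w, reassoc_of% hs])
  have : Mono s := (HasMonoFPCs.mono_of_isFPC Fs).1
  let A : AssocDiagram D₂₁ D₃₂ (D₃₂.n₂ ≫ pushout.inl D₃₂.o₁' t) n₂₁ x₃₂ x₁ :=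
    ⟨K, s, t, _, b, _, v, Ga, Gb, rfl, hn.symm, hv₂, hv₁, hs, hn'.symm, F.isPullback.w.symm⟩
  exact ⟨_, _, n₂₁, inferInstance, Adhesive.mono_of_isPushout_of_mono_right A.isPushout_n₂₁_a, ⟨A⟩⟩

theorem exists_context_p₁ (A : AssocDiagram D₂₁ D₃₂ n₃ n₂₁ x₃₂ x₁) {B I : C} {g : D₂₁.K₂₁ ⟶ B}
    {ω : B ⟶ N} {y : D₂₁.I₂₁ ⟶ I} {z : B ⟶ I} (G : IsPushout (D₂₁.i₂'' ≫ D₂₁.o₂') g n₂₁ ω)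
    (H : IsPushout (D₂₁.o₁'' ≫ D₂₁.i₁') g y z) :
    ∃ (L : C) (k : p₁.K ⟶ L) (o : L ⟶ X) (i : L ⟶ I) (r : B ⟶ A.K) (h : B ⟶ L),
      IsPushout p₁.o k x₁ o ∧ IsPushout p₁.i k (D₂₁.nstar₁ ≫ y) i ∧ IsPullback r h A.b o ∧
        r ≫ A.a = ω ∧ h ≫ i = z := by
  obtain ⟨L, j, h, r, o, hr, HL, Ho, Hb⟩ := A.exists_complement_x₁ G
  obtain ⟨i, hi, rfl⟩ := HL.exists_desc (D₂₁.i₁' ≫ y) z (by simpa using H.w)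
  exact ⟨L, _, o, i, r, h, Ho, D₂₁.isPushout_I.paste_vert (H.of_left hi.symm HL), Hb, hr, rfl⟩

theorem exists_context_p₃ [Mono n₃] [Mono x₃₂] (A : AssocDiagram D₂₁ D₃₂ n₃ n₂₁ x₃₂ x₁)
    {Q O L : C} {κ : p₃.K ⟶ Q} {ι : Q ⟶ N} {y : p₃.O ⟶ O} {z : Q ⟶ O} {l₁ : L ⟶ Q} {l₂ : L ⟶ A.K}
    (F : IsFPC p₃.i n₃ κ ι) (H : IsPushout p₃.o κ y z) (hL : IsPullback l₁ l₂ ι A.a) :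
    ∃ (k : D₃₂.K₂₁ ⟶ L) (y' : D₃₂.O₂₁ ⟶ O), IsFPC (D₃₂.o₁'' ≫ D₃₂.i₁') x₃₂ k (l₂ ≫ A.b) ∧
      IsPushout (D₃₂.i₂'' ≫ D₃₂.o₂') k y' (l₁ ≫ z) := by
  have : Mono ι := (HasMonoFPCs.mono_of_isFPC F).2
  have : Mono l₂ := hL.mono_snd_of_mono
  have hu := A.n₂_u.symm ▸ F
  obtain ⟨w, rfl, Fw⟩ := D₃₂.isFPC.exists_of_paste_horiz hu
  obtain ⟨k, Fk, Hk⟩ := exists_isFPC_isPushout_of_cube D₃₂.isPullback_K Fw A.isPushout_u_a hL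
  obtain ⟨y', hy, hy'⟩ := D₃₂.isPushout_O.exists_desc y (w ≫ z) (by simpa using H.w)
  rw [← hy] at H
  exact ⟨k, y', A.isFPC_x₃₂_b.paste_vert Fk, Hk.paste_horiz (H.of_top hy' D₃₂.isPushout_O)⟩

theorem isIsomorphic_composite {m₃₂₁ : Overlap p₃ D₂₁.composite} {m₃₂₁' : Overlap D₃₂.composite p₁}
    (E : CompositionDiagram m₃₂₁) (F : CompositionDiagram m₃₂₁')
    (A : AssocDiagram D₂₁ D₃₂ E.n₂ E.n₁ F.n₂ F.n₁) : E.composite.IsIsomorphic F.composite := by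
  have : Mono (X := D₃₂.I₂₁) F.n₂ := inferInstanceAs (Mono F.n₂)
  obtain ⟨L, k₁, o₁, i₁, r, h, Ho₁, Hi₁, Hb, hr, hi₁⟩ :=
    A.exists_context_p₁ E.isPushout_complement E.isPushout_I
  have hL := IsPullback.of_hasPullback E.i₂' A.a
  obtain ⟨k₂, y, F₂, Ho₂⟩ := A.exists_context_p₃ E.isFPC E.isPushout_O hL
  have hK := E.isPullback_K
  rw [← hr] at hK
  obtain ⟨l, hl₁, hl₂⟩ := hL.exists_lift E.i₂'' (E.o₁'' ≫ r) (by simpa using hK.w)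
  have Hl := (IsPullback.of_right (hl₁.symm ▸ hK) hl₂ hL).paste_vert Hb
  let F' : CompositionDiagram m₃₂₁' :=
    ⟨_, _, _, F.isPushout_N, _, _, _, Ho₁, _, _, _, Hi₁, _, _, _, F₂, _, _, _, Ho₂, _, _, _, Hl⟩
  have hEF : E.composite.IsIsomorphic F'.composite := by
    refine ⟨Iso.refl _, Iso.refl _, Iso.refl _, ?_, ?_⟩
    · simp [CompositionDiagram.composite, F', reassoc_of% hl₁]
    · simp [CompositionDiagram.composite, F', hi₁]
  exact hEF.trans (F'.isIsomorphic_composite F)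

end AssocDiagram

end

namespace AdmissibleMatch

/-- The chosen representative of an admissible match, from which `comp` is computed. -/
noncomputable def overlap (m : AdmissibleMatch p₂ p₁) : Overlap p₂ p₁ := (Quotient.out m).1

theorem eq_of_isPullback {m m' : AdmissibleMatch p₂ p₁} {Z Z' : C} {y : p₂.I ⟶ Z} {z : p₁.O ⟶ Z}
    {y' : p₂.I ⟶ Z'} {z' : p₁.O ⟶ Z'} (H : IsPullback m.overlap.m₂ m.overlap.m₁ y z)
    (H' : IsPullback m'.overlap.m₂ m'.overlap.m₁ y' z')
    (h : ∃ f : Z ⟶ Z', y ≫ f = y' ∧ z ≫ f = z') (h' : ∃ f : Z' ⟶ Z, y' ≫ f = y ∧ z' ≫ f = z) :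
    m = m' := by
  obtain ⟨f, hy, hz⟩ := h
  obtain ⟨f', hy', hz'⟩ := h'
  obtain ⟨k, hk₂, hk₁⟩ := H'.exists_lift m.overlap.m₂ m.overlap.m₁ (by
    rw [← hy, ← hz, H.w_assoc])
  obtain ⟨l, hl₂, -⟩ := H.exists_lift m'.overlap.m₂ m'.overlap.m₁ (by
    rw [← hy', ← hz', H'.w_assoc])
  let e : m.overlap.M ≅ m'.overlap.M :=
    ⟨k, l, by rw [← cancel_mono m.overlap.m₂]; simp [hl₂, hk₂],
      by rw [← cancel_mono m'.overlap.m₂]; simp [hl₂, hk₂]⟩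
  exact Quotient.out_equiv_out.1 ⟨e, hk₂, hk₁⟩

variable [Adhesive C]

theorem exists_isPullback {Y Z : C} {k : p₁.K ⟶ Y} {o : Y ⟶ Z} (n₂ : p₂.I ⟶ Z) {n₁ : p₁.O ⟶ Z}
    [Mono n₂] [Mono n₁] (G : IsPushout p₁.o k n₁ o) :
    ∃ m : AdmissibleMatch p₂ p₁, IsPullback m.overlap.m₂ m.overlap.m₁ n₂ n₁ := by
  have H := IsPullback.of_hasPullback n₂ n₁
  have HP := IsPushout.of_hasPushout (pullback.fst n₂ n₁) (pullback.snd n₂ n₁)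
  obtain ⟨u, _, -, hu⟩ := exists_mono_desc HP H
  rw [← hu] at G
  let m : { m : Overlap p₂ p₁ // m.IsAdmissible } :=
    ⟨⟨_, pullback.fst n₂ n₁, pullback.snd n₂ n₁⟩,
      _, _, _, HP, exists_isPushout_of_isPushout_comp_mono G⟩
  obtain ⟨e, h₂, h₁⟩ := Quotient.mk_out (s := overlapSetoid p₂ p₁) m
  exact ⟨Quotient.mk _ m, H.of_iso e.symm (Iso.refl _) (Iso.refl _) (Iso.refl _)
    (by simp [← h₂, m, overlap]) (by simp [← h₁, m, overlap]) (by simp) (by simp)⟩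

variable [HasPullbacks C] [HasMonoFPCs C]

/-- The chosen composition diagram of an admissible match; `comp` is by definition its composite. -/
noncomputable def diagram (m : AdmissibleMatch p₂ p₁) : CompositionDiagram m.overlap :=
  Classical.choice (CompositionDiagram.nonempty (Quotient.out m).2)

end AdmissibleMatch

variable [HasPullbacks C] [Adhesive C] [HasMonoFPCs C]

namespace AssocDiagram

theorem exists_right {m₂₁ : Overlap p₂ p₁} {D₂₁ : CompositionDiagram m₂₁} {N B : C}
    (n₃ : p₃.I ⟶ N) {n₂₁ : D₂₁.O₂₁ ⟶ N} [Mono n₃] [Mono n₂₁] {g : D₂₁.K₂₁ ⟶ B} {ω : B ⟶ N}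
    (G : IsPushout (D₂₁.i₂'' ≫ D₂₁.o₂') g n₂₁ ω) :
    ∃ (m₃₂ : AdmissibleMatch p₃ p₂) (X : C) (x₃₂ : m₃₂.diagram.I₂₁ ⟶ X) (x₁ : p₁.O ⟶ X),
      Mono x₃₂ ∧ Mono x₁ ∧ Nonempty (AssocDiagram D₂₁ m₃₂.diagram n₃ n₂₁ x₃₂ x₁) := by
  have Gs := G.of_left' (IsPushout.of_hasPushout D₂₁.i₂'' g)
  obtain ⟨m₃₂, H⟩ := AdmissibleMatch.exists_isPullback n₃ (D₂₁.isPushout_O.paste_vert Gs)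
  exact ⟨m₃₂, exists_of_isPullback_n m₃₂.diagram Gs H⟩

theorem exists_left {m₃₂ : Overlap p₃ p₂} {D₃₂ : CompositionDiagram m₃₂} {M X L : C}
    {x₃₂ : D₃₂.I₂₁ ⟶ X} {x₁ : p₁.O ⟶ X} [Mono x₃₂] [Mono x₁] {l₃₂ : M ⟶ D₃₂.I₂₁} {l₁ : M ⟶ p₁.O}
    (H : IsPushout l₃₂ l₁ x₃₂ x₁) {k : p₁.K ⟶ L} {o : L ⟶ X} (G : IsPushout p₁.o k x₁ o) :
    ∃ (m₂₁ : AdmissibleMatch p₂ p₁) (N : C) (n₃ : p₃.I ⟶ N) (n₂₁ : m₂₁.diagram.O₂₁ ⟶ N),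
      Mono n₃ ∧ Mono n₂₁ ∧ Nonempty (AssocDiagram m₂₁.diagram D₃₂ n₃ n₂₁ x₃₂ x₁) := by
  obtain ⟨m₂₁, H'⟩ := AdmissibleMatch.exists_isPullback (D₃₂.nstar₁ ≫ x₃₂) G
  exact ⟨m₂₁, exists_of_isPullback_x m₂₁.diagram H H'⟩

end AssocDiagram

/-- The correspondence of the associativity theorem: two nested compositions are related if they
have a common refinement. -/
def IsAssocPair (x : Σ m₂₁ : AdmissibleMatch p₂ p₁, AdmissibleMatch p₃ (comp p₂ m₂₁))
    (y : Σ m₃₂ : AdmissibleMatch p₃ p₂, AdmissibleMatch (comp p₃ m₃₂) p₁) : Prop :=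
  Nonempty (AssocDiagram x.1.diagram y.1.diagram x.2.diagram.n₂ x.2.diagram.n₁ y.2.diagram.n₂
    y.2.diagram.n₁)

namespace IsAssocPair

variable {x x' : Σ m₂₁ : AdmissibleMatch p₂ p₁, AdmissibleMatch p₃ (comp p₂ m₂₁)}
  {y y' : Σ m₃₂ : AdmissibleMatch p₃ p₂, AdmissibleMatch (comp p₃ m₃₂) p₁}

theorem isIsomorphic (h : IsAssocPair x y) :
    (comp p₃ x.2).IsIsomorphic (comp (comp p₃ y.1) y.2) :=
  h.some.isIsomorphic_composite x.2.diagram y.2.diagram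

theorem exists_right (x : Σ m₂₁ : AdmissibleMatch p₂ p₁, AdmissibleMatch p₃ (comp p₂ m₂₁)) :
    ∃ y : Σ m₃₂ : AdmissibleMatch p₃ p₂, AdmissibleMatch (comp p₃ m₃₂) p₁, IsAssocPair x y := by
  obtain ⟨m₂₁, m⟩ := x
  let E := m.diagram
  have : Mono (X := m₂₁.diagram.O₂₁) E.n₁ := inferInstanceAs (Mono E.n₁)
  obtain ⟨m₃₂, X, x₃₂, x₁, _, _, ⟨A⟩⟩ :=
    AssocDiagram.exists_right (D₂₁ := m₂₁.diagram) E.n₂ E.isPushout_complement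
  obtain ⟨_, _, _, _, _, _, Go, -⟩ := A.exists_context_p₁ E.isPushout_complement E.isPushout_I
  have : Mono (X := (comp p₃ m₃₂).I) x₃₂ := inferInstanceAs (Mono (X := m₃₂.diagram.I₂₁) x₃₂)
  obtain ⟨m', H'⟩ := AdmissibleMatch.exists_isPullback (p₂ := comp p₃ m₃₂) x₃₂ Go
  have : Mono (Y := m₃₂.diagram.I₂₁) m'.overlap.m₂ := inferInstanceAs (Mono m'.overlap.m₂)
  have P := A.isPushout_x₃₂_x₁ E.isPushout_N H'
  have P' := m'.diagram.isPushout_N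
  exact ⟨⟨m₃₂, m'⟩, ⟨A.ofIso (Iso.refl _) (P.isoIsPushout _ _ P') (Category.comp_id _)
    (Category.comp_id _) (P.inl_isoIsPushout_hom _ _ P') (P.inr_isoIsPushout_hom _ _ P')⟩⟩

theorem exists_left (y : Σ m₃₂ : AdmissibleMatch p₃ p₂, AdmissibleMatch (comp p₃ m₃₂) p₁) :
    ∃ x : Σ m₂₁ : AdmissibleMatch p₂ p₁, AdmissibleMatch p₃ (comp p₂ m₂₁), IsAssocPair x y := by
  obtain ⟨m₃₂, m⟩ := y
  let F := m.diagram
  have : Mono (X := m₃₂.diagram.I₂₁) F.n₂ := inferInstanceAs (Mono F.n₂)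
  have : Mono (Y := m₃₂.diagram.I₂₁) m.overlap.m₂ := inferInstanceAs (Mono m.overlap.m₂)
  obtain ⟨m₂₁, N, n₃, n₂₁, _, _, ⟨A⟩⟩ :=
    AssocDiagram.exists_left (D₃₂ := m₃₂.diagram) F.isPushout_N F.isPushout_complement
  obtain ⟨_, _, _, Go⟩ := A.exists_complement_n₂₁ F.isPushout_complement
  have : Mono (X := (comp p₂ m₂₁).O) n₂₁ := inferInstanceAs (Mono (X := m₂₁.diagram.O₂₁) n₂₁)
  obtain ⟨m', H'⟩ := AdmissibleMatch.exists_isPullback (p₁ := comp p₂ m₂₁) n₃ Go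
  have P := A.isPushout_n₃_n₂₁ H' F.isPushout_N
  have P' := m'.diagram.isPushout_N
  exact ⟨⟨m₂₁, m'⟩, ⟨A.ofIso (P.isoIsPushout _ _ P') (Iso.refl _) (P.inl_isoIsPushout_hom _ _ P')
    (P.inr_isoIsPushout_hom _ _ P') (Category.comp_id _) (Category.comp_id _)⟩⟩

theorem right_unique (h : IsAssocPair x y) (h' : IsAssocPair x y') : y = y' := by
  obtain ⟨m₃₂, m⟩ := y
  obtain ⟨m₃₂', m'⟩ := y'
  obtain ⟨A⟩ := h
  obtain ⟨A'⟩ := h'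
  have : Mono (X := m₃₂.diagram.I₂₁) m.diagram.n₂ := inferInstanceAs (Mono m.diagram.n₂)
  have : Mono (X := m₃₂'.diagram.I₂₁) m'.diagram.n₂ := inferInstanceAs (Mono m'.diagram.n₂)
  obtain rfl : m₃₂ = m₃₂' := AdmissibleMatch.eq_of_isPullback A.isPullback_m₃₂ A'.isPullback_m₃₂
    ⟨𝟙 _, by simp, by simp⟩ ⟨𝟙 _, by simp, by simp⟩
  obtain rfl : m = m' := AdmissibleMatch.eq_of_isPullback
    (Adhesive.isPullback_of_isPushout_of_mono_left m.diagram.isPushout_N)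
    (Adhesive.isPullback_of_isPushout_of_mono_left m'.diagram.isPushout_N)
    (A.exists_hom_x A') (A'.exists_hom_x A)
  rfl

theorem left_unique (h : IsAssocPair x y) (h' : IsAssocPair x' y) : x = x' := by
  obtain ⟨m₂₁, m⟩ := x
  obtain ⟨m₂₁', m'⟩ := x'
  obtain ⟨A⟩ := h
  obtain ⟨A'⟩ := h'
  have : Mono (X := m₂₁.diagram.O₂₁) m.diagram.n₁ := inferInstanceAs (Mono m.diagram.n₁)
  have : Mono (X := m₂₁'.diagram.O₂₁) m'.diagram.n₁ := inferInstanceAs (Mono m'.diagram.n₁)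
  obtain rfl : m₂₁ = m₂₁' := AdmissibleMatch.eq_of_isPullback A.isPullback_m₂₁ A'.isPullback_m₂₁
    ⟨𝟙 _, by simp, by simp⟩ ⟨𝟙 _, by simp, by simp⟩
  obtain rfl : m = m' := AdmissibleMatch.eq_of_isPullback
    (Adhesive.isPullback_of_isPushout_of_mono_left m.diagram.isPushout_N)
    (Adhesive.isPullback_of_isPushout_of_mono_left m'.diagram.isPushout_N)
    (A.exists_hom_n A') (A'.exists_hom_n A)
  rfl

end IsAssocPair

end SqPO

theorem mainTheorem2 {C : Type u} [Category.{v} C] [HasPullbacks C] [Adhesive C]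
    [SqPO.HasMonoFPCs C] (p₁ p₂ p₃ : SqPO.LinearProduction C) :
    ∃ e : (Σ m₂₁ : SqPO.AdmissibleMatch p₂ p₁, SqPO.AdmissibleMatch p₃ (SqPO.comp p₂ m₂₁)) ≃
        (Σ m₃₂ : SqPO.AdmissibleMatch p₃ p₂, SqPO.AdmissibleMatch (SqPO.comp p₃ m₃₂) p₁),
      ∀ x, (SqPO.comp p₃ x.2).IsIsomorphic (SqPO.comp (SqPO.comp p₃ (e x).1) (e x).2) := by
  choose f hf using SqPO.IsAssocPair.exists_right (p₁ := p₁) (p₂ := p₂) (p₃ := p₃)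
  choose g hg using SqPO.IsAssocPair.exists_left (p₁ := p₁) (p₂ := p₂) (p₃ := p₃)
  exact ⟨⟨f, g, fun x => (hg (f x)).left_unique (hf x), fun y => (hf (g y)).right_unique (hg y)⟩,
    fun x => (hf x).isIsomorphic⟩
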